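/- Let $n\ge 2$, $\lambda\ge 1$, $1\le s\le k$ and $1\le p_{\max}\le\lambda$ be integers, let $[k]=\{1,\dots,k\}$, and let $L$ be a set of $n$ symbols. Vectors ${\bf x}\in\mathbb{R}^{n^k}$ are indexed by the symbol combinations $(i_1,\dots,i_k)\in L^k$. For $u\subseteq[k]$ define the ANOVA component $x_u$ recursively by $$x_u(i_1,\dots,i_k)=n^{-k+|u|}\sum_{\{i_j\,:\,j\notin u\}}x(i_1,\dots,i_k)-\sum_{v\subsetneq u}x_v(i_1,\dots,i_k),$$ and the $J$-characteristics by $J^{\bf x}_u(i_1,\dots,i_k)=n^k x_u(i_1,\dots,i_k)$. Call ${\bf x}$ feasible if it satisfies the equality constraints $$J^{\bf x}_\emptyset(i_1,\dots,i_k)=\lambda n^s,\qquad J^{\bf x}_u(i_1,\dots,i_k)=0\quad\text{for all } u\subseteq[k]\text{ with }1\le|u|\le s,\ \text{ for all }(i_1,\dots,i_k)\in L^k, \tag{1}$$ and all entries of ${\bf x}$ are integers with $0\le x(i_1,\dots,i_k)\le p_{\max}$. Let $S_n\wr S_k$ act on $L^k$ by $((h_1,\dots,h_k),g)(i_1,\dots,i_k)=(h_1(i_{g^{-1}(1)}),\dots,h_k(i_{g^{-1}(k)}))$,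 where $h_1,\dots,h_k$ are permutations of $L$ and $g$ is a permutation of $[k]$, and on $\mathbb{R}^{n^k}$ by the corresponding permutation of the entries. Let $$\Omega=\left\{\ell\in\{1,\dots,k-s\}\ \middle|\ \lambda\binom{s+\ell-1}{\ell-1}\equiv 0\pmod n\right\}.$$ Let ${\bf x}$ be feasible. Then there exists $T\subseteq\Omega$ such that the following hold. (i) $$\dim\operatorname{Conv}((S_n\wr S_k){\bf x})=n^k-\sum_{j=0}^{s}\binom kj(n-1)^j-\sum_{\ell\in T}\binom{k}{s+\ell}(n-1)^{s+\ell}.$$ (ii) There exist $r\ge 0$ and $u_1,\dots,u_r\subseteq[k]$ with $|u_j|=s+\ell_j\le k$, $\ell_j\in T$, such that $\operatorname{Aff}(\operatorname{Conv}((S_n\wr S_k){\bf x}))=\operatorname{Aff}((S_n\wr S_k){\bf x})$ is exactly the set of all ${\bf z}\in\mathbb{R}^{n^k}$ that satisfy the equality constraints (1) together with $$J^{\bf z}_{u''}(i_1,\dots,i_k)=0\quad\text{for all }u''\subseteq[k]\text{ with }|u''|=|u_j|\text{ and all }(i_1,\dots,i_k)\in L^k,\qquad j=1,\dots,r.$$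 -/

import Mathlib

namespace OAPolytope

/-- Symbol combinations `(i₁, …, i_k)`, the index set of frequency vectors. -/
abbrev Idx (n k : ℕ) : Type := Fin k → Fin n

/-- Real vectors indexed by the `n ^ k` symbol combinations. -/
abbrev Vec (n k : ℕ) : Type := Idx n k → ℝ

/-- The sum of the entries `x i'` over all `i'` that agree with `i` on the coordinates in `u`
(that is, `i_j` is summed out for `j ∉ u`). -/
noncomputable def marginal {n k : ℕ} (x : Vec n k) (u : Finset (Fin k)) (i : Idx n k) : ℝ :=
  ∑ i' : Idx n k with ∀ j ∈ u, i' j = i j, x i'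

/-- The component `x_u` of the ANOVA decomposition of `x`, defined recursively by
`x_u = n ^ (-k + |u|) * (marginal of x on u) - ∑_{v ⊊ u} x_v`. -/
noncomputable def anova {n k : ℕ} (x : Vec n k) (u : Finset (Fin k)) : Vec n k := fun i =>
  (n : ℝ) ^ (-(k : ℤ) + (u.card : ℤ)) * marginal x u i
    - ∑ v : {v : Finset (Fin k) // v ∈ u.ssubsets}, anova x v.1 i
  termination_by u.card
  decreasing_by exact Finset.card_lt_card (Finset.mem_ssubsets.mp v.2)

/-- The `J`-characteristics `J_u^x(i₁, …, i_k) = n ^ k * x_u(i₁, …, i_k)`. -/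
noncomputable def J {n k : ℕ} (x : Vec n k) (u : Finset (Fin k)) (i : Idx n k) : ℝ :=
  (n : ℝ) ^ k * anova x u i

/-- The equality constraints of the integer linear description of `OA(lam * n ^ s, k, n, s)`. -/
def EqConstraints {n k : ℕ} (s lam : ℕ) (x : Vec n k) : Prop :=
  (∀ i, J x ∅ i = (lam : ℝ) * (n : ℝ) ^ s) ∧
    ∀ u : Finset (Fin k), 1 ≤ u.card → u.card ≤ s → ∀ i, J x u i = 0

/-- Feasible points of the integer linear description of `OA(lam * n ^ s, k, n, s)`, with upper
bound `pmax` on the variables. -/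
def IsFeasible {n k : ℕ} (s lam pmax : ℕ) (x : Vec n k) : Prop :=
  EqConstraints s lam x ∧ ∀ i, 0 ≤ x i ∧ x i ≤ (pmax : ℝ) ∧ ∃ m : ℤ, x i = (m : ℝ)

/-- The wreath product `S_n ≀ S_k`: the semidirect product of `(S_n) ^ k` by `S_k`, where
`g ∈ S_k` sends `(h_j)_j` to `(h_{g⁻¹ j})_j`. -/
abbrev Wreath (n k : ℕ) : Type :=
  SemidirectProduct (Fin k → Equiv.Perm (Fin n)) (Equiv.Perm (Fin k)) mulAutArrow

/-- `((h₁, …, h_k), g)` sends `(i₁, …, i_k)` to `(h₁ (i_{g⁻¹ 1}), …, h_k (i_{g⁻¹ k}))`. -/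
instance wreathAction (n k : ℕ) : MulAction (Wreath n k) (Idx n k) where
  smul a i := fun j => a.left j (i (a.right⁻¹ j))
  one_smul _ := rfl
  mul_smul _ _ _ := rfl

/-- The orbit of `x` under the action of `S_n ≀ S_k` that permutes the entries of `x`. -/
def wreathOrbit {n k : ℕ} (x : Vec n k) : Set (Vec n k) :=
  Set.range fun (a : Wreath n k) => fun i => x (a⁻¹ • i)

/-- The dimension of a (nonempty) subset of `Vec n k`: that of its affine hull. -/
noncomputable def dim {n k : ℕ} (S : Set (Vec n k)) : ℕ :=
  Module.finrank ℝ (affineSpan ℝ S).direction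

/-- The set `Ω` of all `ℓ ∈ {1, …, k - s}` with `lam * (s + ℓ - 1 choose ℓ - 1) ≡ 0 (mod n)`. -/
def Omega (n k s lam : ℕ) : Finset ℕ :=
  {l ∈ Finset.Icc 1 (k - s) | lam * (s + l - 1).choose (l - 1) ≡ 0 [MOD n]}

end OAPolytope

/-! The ANOVA components are the images of `x` under commuting projections, tensor products of the
two complementary projections `δ - 1/n` and `1/n` on functions of one coordinate. The wreath product
permutes them within each level `|u|`. The core is that each level behaves irreducibly and distinct
levels separate: if some level `m ≥ 1` component of `x` is nonzero, the direction space of the orbit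
contains all of level `m` (`anovaProj_mem_vectorSpan`). The reason is that a signed combination of
symbol permutations acts as the rank-one operator `x ↦ ⟨d, x⟩ d`, with `d` a product of differences
`δ_a - δ_b`; the translates of one such `d` span its level.

So the direction space is cut out by the levels at which `x` vanishes, together with level 0, which
is constant on the orbit. `T` records the vanishing levels above `s`; traces of projections give the
dimension.

For `T ⊆ Ω`, a vanishing component is an alternating sum of marginals. After scaling, marginals on
at most `s` coordinates equal `lam` and the others are multiples of `n`, so `n` divides `lam` times
a truncated alternating sum of binomials. -/

namespace OAPolytope

open Finset

variable {n k : ℕ}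

/-! ### ANOVA components as orthogonal projections -/

/-- The kernel of the projection onto the `u`-component of the ANOVA decomposition: a product of
the one-dimensional kernels `δ - 1 / n` (for coordinates in `u`) and `1 / n` (for the others). -/
noncomputable def anovaKernel (u : Finset (Fin k)) (i a : Idx n k) : ℝ :=
  ∏ c, if c ∈ u then (if i c = a c then 1 else 0) - (n : ℝ)⁻¹ else (n : ℝ)⁻¹

/-- The projection onto the `u`-component of the ANOVA decomposition. -/
noncomputable def anovaProj (u : Finset (Fin k)) : Vec n k →ₗ[ℝ] Vec n k :=
  Matrix.toLin' (Matrix.of (anovaKernel u))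

theorem anovaProj_apply (u : Finset (Fin k)) (x : Vec n k) (i : Idx n k) :
    anovaProj u x i = ∑ a, anovaKernel u i a * x a := by
  simp [anovaProj, Matrix.mulVec, dotProduct]

theorem anovaKernel_comm (u : Finset (Fin k)) (i a : Idx n k) :
    anovaKernel u i a = anovaKernel u a i := by
  simp only [anovaKernel, eq_comm]

theorem prod_ite_eq_ite_forall (u : Finset (Fin k)) (i a : Idx n k) :
    ∏ c ∈ u, (if i c = a c then (1 : ℝ) else 0) = if ∀ c ∈ u, a c = i c then 1 else 0 := by
  rw [Finset.prod_boole]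
  simp only [fun c => eq_comm (a := a c) (b := i c)]
  congr

theorem prod_ite_mem_const (u : Finset (Fin k)) (f : Fin k → ℝ) (b : ℝ) :
    (∏ c, if c ∈ u then f c else b) = (∏ c ∈ u, f c) * b ^ (k - u.card) := by
  rw [Finset.prod_ite]
  congr 1
  · simp
  · rw [Finset.prod_const]
    congr 1
    rw [Finset.filter_not, Finset.card_sdiff_of_subset (Finset.filter_subset _ _)]
    simp

theorem marginal_eq_sum (x : Vec n k) (u : Finset (Fin k)) (i : Idx n k) :
    marginal x u i = ∑ a, (∏ c ∈ u, if i c = a c then (1 : ℝ) else 0) * x a := by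
  simp only [marginal, prod_ite_eq_ite_forall, Finset.sum_filter, ite_mul, one_mul, zero_mul]

/-- Expand the product over `c ∈ u` of `(δ - 1/n) + 1/n`. -/
theorem sum_anovaKernel_powerset (u : Finset (Fin k)) (i a : Idx n k) :
    ∑ v ∈ u.powerset, anovaKernel v i a =
      (∏ c ∈ u, if i c = a c then (1 : ℝ) else 0) * (n : ℝ)⁻¹ ^ (k - u.card) := by
  have h := Finset.prod_add (fun c => (if i c = a c then (1 : ℝ) else 0) - (n : ℝ)⁻¹)
    (fun _ => (n : ℝ)⁻¹) u
  simp only [sub_add_cancel] at h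
  rw [h, Finset.sum_mul]
  refine Finset.sum_congr rfl fun v hv => ?_
  have hvu := Finset.mem_powerset.mp hv
  have hk : u.card ≤ k := by simpa using Finset.card_le_univ u
  rw [anovaKernel, prod_ite_mem_const, Finset.prod_const, Finset.card_sdiff_of_subset hvu,
    mul_assoc, ← pow_add]
  congr 2
  have := Finset.card_le_card hvu
  omega

theorem sum_anovaProj_powerset (x : Vec n k) (u : Finset (Fin k)) (i : Idx n k) :
    ∑ v ∈ u.powerset, anovaProj v x i = (n : ℝ)⁻¹ ^ (k - u.card) * marginal x u i := by
  simp only [anovaProj_apply]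
  rw [Finset.sum_comm, marginal_eq_sum, Finset.mul_sum]
  refine Finset.sum_congr rfl fun a _ => ?_
  rw [← Finset.sum_mul, sum_anovaKernel_powerset]
  ring

theorem anova_eq_anovaProj (x : Vec n k) (u : Finset (Fin k)) : anova x u = anovaProj u x := by
  induction u using Finset.strongInduction with
  | H u ih =>
    funext i
    have hk : u.card ≤ k := by simpa using Finset.card_le_univ u
    have hpow : (n : ℝ) ^ (-(k : ℤ) + (u.card : ℤ)) = (n : ℝ)⁻¹ ^ (k - u.card) := by
      rw [inv_pow, ← zpow_natCast, ← zpow_neg]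
      congr 1
      omega
    rw [anova, hpow, ← sum_anovaProj_powerset]
    have : ∑ v : {v : Finset (Fin k) // v ∈ u.ssubsets}, anova x v.1 i =
        ∑ v ∈ u.ssubsets, anovaProj v x i := by
      rw [← Finset.sum_coe_sort u.ssubsets]
      exact Finset.sum_congr rfl fun v _ => by rw [ih v.1 (Finset.mem_ssubsets.mp v.2)]
    rw [this, Finset.ssubsets,
      ← Finset.add_sum_erase u.powerset _ (Finset.mem_powerset_self u)]
    ring

theorem sum_anovaProj (x : Vec n k) : ∑ u, anovaProj u x = x := by
  funext i
  have h := sum_anovaProj_powerset x univ i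
  rw [Finset.powerset_univ] at h
  simp only [Finset.sum_apply, h, Finset.card_univ, Fintype.card_fin, Nat.sub_self, pow_zero,
    one_mul, marginal, Finset.mem_univ, true_implies]
  rw [Finset.sum_eq_single i]
  · intro b hb hbi
    exact absurd (funext (Finset.mem_filter.mp hb).2) hbi
  · simp

/-- The sum factors over coordinates, where `δ - 1/n` and `1/n` are idempotents with product zero.
-/
theorem sum_anovaKernel_mul [NeZero n] (u v : Finset (Fin k)) (i a : Idx n k) :
    ∑ b, anovaKernel u i b * anovaKernel v b a = if u = v then anovaKernel u i a else 0 := by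
  have hn : (n : ℝ) ≠ 0 := NeZero.ne _
  have key (c : Fin k) : (∑ t : Fin n,
      (if c ∈ u then (if i c = t then 1 else 0) - (n : ℝ)⁻¹ else (n : ℝ)⁻¹) *
        (if c ∈ v then (if t = a c then 1 else 0) - (n : ℝ)⁻¹ else (n : ℝ)⁻¹)) =
      if (c ∈ u ↔ c ∈ v) then
        (if c ∈ u then (if i c = a c then 1 else 0) - (n : ℝ)⁻¹ else (n : ℝ)⁻¹) else 0 := by
    by_cases hu : c ∈ u <;> by_cases hv : c ∈ v <;>
      simp [hu, hv, sub_mul, mul_sub, Finset.sum_sub_distrib, hn]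
  have h : ∑ b, anovaKernel u i b * anovaKernel v b a = ∏ c, if (c ∈ u ↔ c ∈ v) then
      (if c ∈ u then (if i c = a c then 1 else 0) - (n : ℝ)⁻¹ else (n : ℝ)⁻¹) else 0 := by
    simp only [← key, Finset.prod_univ_sum, Fintype.piFinset_univ, anovaKernel,
      Finset.prod_mul_distrib]
  rw [h]
  split_ifs with huv
  · subst huv
    simp [anovaKernel]
  · have : ∃ c, ¬ (c ∈ u ↔ c ∈ v) := by
      by_contra! hc
      exact huv (Finset.ext hc)
    obtain ⟨c, hc⟩ := this
    exact Finset.prod_eq_zero (Finset.mem_univ c) (if_neg hc)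

theorem anovaProj_anovaProj [NeZero n] (u v : Finset (Fin k)) (x : Vec n k) :
    anovaProj u (anovaProj v x) = if u = v then anovaProj u x else 0 := by
  funext i
  simp only [anovaProj_apply, Finset.mul_sum, ← mul_assoc]
  rw [Finset.sum_comm]
  simp only [← Finset.sum_mul, sum_anovaKernel_mul]
  split_ifs <;> simp [anovaProj_apply]

theorem trace_anovaProj [NeZero n] (u : Finset (Fin k)) :
    LinearMap.trace ℝ (Vec n k) (anovaProj u) = ((n : ℝ) - 1) ^ u.card := by
  have hn : (n : ℝ) ≠ 0 := NeZero.ne _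
  rw [anovaProj, Matrix.trace_toLin'_eq, Matrix.trace]
  simp only [Matrix.diag, Matrix.of_apply, anovaKernel]
  have := Finset.prod_univ_sum (fun _ : Fin k => (univ : Finset (Fin n)))
    (fun c (_ : Fin n) => if c ∈ u then 1 - (n : ℝ)⁻¹ else (n : ℝ)⁻¹)
  rw [Fintype.piFinset_univ] at this
  simp only [if_true]
  rw [← this]
  have h (c : Fin k) : (∑ _t : Fin n, if c ∈ u then 1 - (n : ℝ)⁻¹ else (n : ℝ)⁻¹) =
      if c ∈ u then (n : ℝ) - 1 else 1 := by
    split_ifs <;> simp [hn]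
  simp only [h, prod_ite_mem_const, Finset.prod_const, one_pow, mul_one]

/-! ### Equivariance and difference vectors -/

theorem smul_apply (g : Wreath n k) (i : Idx n k) (c : Fin k) :
    (g • i) c = g.left c (i (g.right⁻¹ c)) := rfl

theorem anovaKernel_smul (g : Wreath n k) (u : Finset (Fin k)) (i a : Idx n k) :
    anovaKernel (u.map g.right.toEmbedding) (g • i) (g • a) = anovaKernel u i a := by
  rw [anovaKernel, anovaKernel, ← Equiv.prod_comp g.right]
  simp [smul_apply]

theorem anovaProj_comp_inv_smul (g : Wreath n k) (u : Finset (Fin k)) (x : Vec n k)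
    (i : Idx n k) :
    anovaProj (u.map g.right.toEmbedding) (fun j => x (g⁻¹ • j)) (g • i) = anovaProj u x i := by
  rw [anovaProj_apply, anovaProj_apply, ← Equiv.sum_comp (MulAction.toPerm g)]
  simp [anovaKernel_smul]

/-- The product over `c ∈ u` of the differences `δ_{a_c} - δ_{b_c}` of unit vectors, constant in
the coordinates outside `u`. -/
noncomputable def diffVec (u : Finset (Fin k)) (a b : Idx n k) : Vec n k := fun i =>
  ∏ c ∈ u, ((if i c = a c then 1 else 0) - (if i c = b c then 1 else 0))

theorem diffVec_smul (g : Wreath n k) (u : Finset (Fin k)) (a b i : Idx n k) :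
    diffVec (u.map g.right.toEmbedding) (g • a) (g • b) (g • i) = diffVec u a b i := by
  rw [diffVec, diffVec, Finset.prod_map]
  simp [smul_apply]

theorem diffVec_congr {u : Finset (Fin k)} {a b a' b' : Idx n k} (ha : ∀ c ∈ u, a c = a' c)
    (hb : ∀ c ∈ u, b c = b' c) : diffVec u a b = diffVec u a' b' := by
  funext i
  exact Finset.prod_congr rfl fun c hc => by rw [ha c hc, hb c hc]

theorem diffVec_eq_zero {u : Finset (Fin k)} {a b : Idx n k} {c : Fin k} (hc : c ∈ u)
    (h : a c = b c) : diffVec u a b = 0 := by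
  funext i
  exact Finset.prod_eq_zero hc (by simp [h])

/-- `S_k` is transitive on subsets of a given size, and `S_n` is 2-transitive on symbols in each
coordinate. -/
theorem exists_wreath_smul {u u' : Finset (Fin k)} (hu : u.card = u'.card) {a b a' b' : Idx n k}
    (h : ∀ c ∈ u, a c ≠ b c) (h' : ∀ c ∈ u', a' c ≠ b' c) :
    ∃ g : Wreath n k, u.map g.right.toEmbedding = u' ∧ (∀ c ∈ u', (g • a) c = a' c) ∧
      ∀ c ∈ u', (g • b) c = b' c := by
  obtain ⟨σ, rfl⟩ := Equiv.Perm.exists_map_finset_eq u u' hu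
  have hex (c : Fin k) : ∃ τ : Equiv.Perm (Fin n), c ∈ u.map σ.toEmbedding →
      τ (a (σ⁻¹ c)) = a' c ∧ τ (b (σ⁻¹ c)) = b' c := by
    by_cases hc : c ∈ u.map σ.toEmbedding
    · have hac : a (σ⁻¹ c) ≠ b (σ⁻¹ c) := h _ (by
        obtain ⟨d, hd, rfl⟩ := Finset.mem_map.mp hc
        simpa using hd)
      obtain ⟨τ, hτ⟩ := Equiv.Perm.exists_extending_pair ![a (σ⁻¹ c), b (σ⁻¹ c)] ![a' c, b' c]
        (by simpa [Function.Injective, Fin.forall_fin_two] using ⟨hac, hac.symm⟩)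
        (by simpa [Function.Injective, Fin.forall_fin_two] using ⟨h' c hc, (h' c hc).symm⟩)
      exact ⟨τ, fun _ => ⟨hτ 0, hτ 1⟩⟩
    · exact ⟨1, fun hc' => absurd hc' hc⟩
  choose τ hτ using hex
  exact ⟨⟨τ, σ⟩, rfl, fun c hc => (hτ c hc).1, fun c hc => (hτ c hc).2⟩

/-- Summing `δ_a - δ_t` over all symbols `t` gives `n (δ_a - 1/n)`. Hence the difference vectors of
`u` span the image of `anovaProj u`. -/
theorem sum_diffVec [NeZero n] (u : Finset (Fin k)) (i a : Idx n k) :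
    ∑ b, diffVec u a b i = (∏ c, if c ∈ u then (n : ℝ) else n * n) * anovaKernel u i a := by
  have hn : (n : ℝ) ≠ 0 := NeZero.ne _
  have h (b : Idx n k) : diffVec u a b i =
      ∏ c, if c ∈ u then (if i c = a c then 1 else 0) - (if i c = b c then 1 else 0) else 1 := by
    simp [diffVec, Finset.prod_ite_mem]
  simp only [h]
  rw [← Fintype.piFinset_univ, ← Finset.prod_univ_sum (fun _ : Fin k => (univ : Finset (Fin n)))
    (fun c t => if c ∈ u then (if i c = a c then (1 : ℝ) else 0) - (if i c = t then 1 else 0)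
      else 1), anovaKernel, ← Finset.prod_mul_distrib]
  refine Finset.prod_congr rfl fun c _ => ?_
  split_ifs <;> simp [mul_sub, hn]

/-! ### Rank-one operators from symbol permutations -/

/-- Coefficients on the symbol permutations of one coordinate. -/
noncomputable def permWeight [NeZero n] (u : Finset (Fin k)) (a b : Idx n k) (c : Fin k)
    (σ : Equiv.Perm (Fin n)) : ℝ :=
  if c ∈ u then (if σ = 1 then 1 else 0) - (if σ = Equiv.swap (a c) (b c) then 1 else 0)
  else ∑ t, if σ = Equiv.addLeft t then 1 else 0

/-- Identity minus a transposition is the rank-one matrix `(e_a - e_b)(e_a - e_b)ᵀ`; the cyclic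
translations sum to the all-ones matrix. -/
theorem sum_permWeight_mul [NeZero n] (u : Finset (Fin k)) (a b : Idx n k) (c : Fin k)
    (p q : Fin n) :
    ∑ σ, permWeight u a b c σ * (if σ p = q then 1 else 0) =
      if c ∈ u then ((if q = a c then 1 else 0) - (if q = b c then 1 else 0)) *
        ((if p = a c then 1 else 0) - (if p = b c then 1 else 0)) else 1 := by
  unfold permWeight
  by_cases hc : c ∈ u
  · simp only [hc, sub_mul, Finset.sum_sub_distrib, ite_mul, one_mul, zero_mul, Finset.sum_ite_eq',
      Finset.mem_univ, if_true, Equiv.Perm.one_apply, Equiv.swap_apply_def]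
    grind
  · simp only [hc, if_false, Finset.sum_mul]
    rw [Finset.sum_comm]
    simp only [ite_mul, one_mul, zero_mul, Finset.sum_ite_eq', Finset.mem_univ, if_true,
      Equiv.coe_addLeft]
    rw [Finset.sum_eq_single (q - p)] <;> simp +contextual [eq_sub_iff_add_eq]

theorem sum_permWeight [NeZero n] {u : Finset (Fin k)} (a b : Idx n k) {c : Fin k} (hc : c ∈ u) :
    ∑ σ, permWeight u a b c σ = 0 := by
  simp [permWeight, hc]

/-- The element of the wreath product given by symbol permutations alone. -/
def ofPerms (h : Fin k → Equiv.Perm (Fin n)) : Wreath n k := ⟨h, 1⟩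

theorem ofPerms_smul_apply (h : Fin k → Equiv.Perm (Fin n)) (i : Idx n k) (c : Fin k) :
    (ofPerms h • i) c = h c (i c) := rfl

theorem sum_prod_permWeight_mul [NeZero n] (u : Finset (Fin k)) (a b : Idx n k) (x : Vec n k)
    (i : Idx n k) :
    ∑ h : Fin k → Equiv.Perm (Fin n), (∏ c, permWeight u a b c (h c)) * x ((ofPerms h)⁻¹ • i) =
      (∑ j, diffVec u a b j * x j) * diffVec u a b i := by
  have h1 (h : Fin k → Equiv.Perm (Fin n)) : x ((ofPerms h)⁻¹ • i) =
      ∑ j, (∏ c, if h c (j c) = i c then (1 : ℝ) else 0) * x j := by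
    rw [Finset.sum_eq_single ((ofPerms h)⁻¹ • i)]
    · rw [Finset.prod_eq_one, one_mul]
      intro c _
      rw [← ofPerms_smul_apply, smul_inv_smul, if_pos rfl]
    · intro j _ hj
      have : ∃ c, h c (j c) ≠ i c := by
        by_contra! hc
        exact hj (eq_inv_smul_iff.mpr (funext hc))
      obtain ⟨c, hc⟩ := this
      rw [Finset.prod_eq_zero (Finset.mem_univ c) (if_neg hc), zero_mul]
    · simp
  simp only [h1, Finset.mul_sum, ← mul_assoc, ← Finset.prod_mul_distrib, Finset.sum_mul]
  rw [Finset.sum_comm]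
  refine Finset.sum_congr rfl fun j _ => ?_
  rw [← Finset.sum_mul, ← Fintype.piFinset_univ, ← Finset.prod_univ_sum
    (fun _ : Fin k => (univ : Finset (Equiv.Perm (Fin n))))
    (fun c σ => permWeight u a b c σ * (if σ (j c) = i c then 1 else 0))]
  simp only [sum_permWeight_mul, Finset.prod_ite_mem, Finset.univ_inter, Finset.prod_mul_distrib,
    diffVec]
  ring

/-! ### The direction space of the orbit -/

theorem mem_wreathOrbit (x : Vec n k) (g : Wreath n k) :
    (fun i => x (g⁻¹ • i)) ∈ wreathOrbit x := ⟨g, rfl⟩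

theorem self_mem_wreathOrbit (x : Vec n k) : x ∈ wreathOrbit x := ⟨1, by simp⟩

theorem comp_inv_smul_mem_vectorSpan {x y : Vec n k} (hy : y ∈ vectorSpan ℝ (wreathOrbit x))
    (g : Wreath n k) : (fun i => y (g⁻¹ • i)) ∈ vectorSpan ℝ (wreathOrbit x) := by
  rw [vectorSpan_def] at hy
  induction hy using Submodule.span_induction with
  | mem y hy =>
    obtain ⟨_, ⟨g₁, rfl⟩, _, ⟨g₂, rfl⟩, rfl⟩ := Set.mem_vsub.mp hy
    have := vsub_mem_vectorSpan ℝ (mem_wreathOrbit x (g * g₁)) (mem_wreathOrbit x (g * g₂))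
    simpa [mul_smul, Pi.sub_def] using this
  | zero => exact Submodule.zero_mem _
  | add y z _ _ hy hz => exact Submodule.add_mem _ hy hz
  | smul r y _ hy => exact Submodule.smul_mem _ r hy

/-- As `u` is nonempty, the weights sum to zero, so the weighted sum of orbit points is a
combination of their differences. -/
theorem diffVec_mem_vectorSpan [NeZero n] {x : Vec n k} {u : Finset (Fin k)} (hu : u.Nonempty)
    {a b : Idx n k} (h : ∑ j, diffVec u a b j * x j ≠ 0) :
    diffVec u a b ∈ vectorSpan ℝ (wreathOrbit x) := by
  rw [← Submodule.smul_mem_iff _ h]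
  have hw : ∑ f : Fin k → Equiv.Perm (Fin n), ∏ c, permWeight u a b c (f c) = 0 := by
    rw [← Fintype.piFinset_univ, ← Finset.prod_univ_sum
      (fun _ : Fin k => (univ : Finset (Equiv.Perm (Fin n)))) (permWeight u a b)]
    obtain ⟨c, hc⟩ := hu
    exact Finset.prod_eq_zero (Finset.mem_univ c) (sum_permWeight a b hc)
  have heq : (∑ j, diffVec u a b j * x j) • diffVec u a b =
      ∑ f : Fin k → Equiv.Perm (Fin n), (∏ c, permWeight u a b c (f c)) •
        ((fun i => x ((ofPerms f)⁻¹ • i)) - x) := by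
    simp only [smul_sub, Finset.sum_sub_distrib, ← Finset.sum_smul, hw, zero_smul, sub_zero]
    funext i
    simp [← sum_prod_permWeight_mul]
  rw [heq]
  exact Submodule.sum_mem _ fun f _ => Submodule.smul_mem _ _
    (vsub_mem_vectorSpan ℝ (mem_wreathOrbit x _) (self_mem_wreathOrbit x))

theorem anovaProj_mem_vectorSpan [NeZero n] {x : Vec n k} {u v : Finset (Fin k)}
    (hu : u.Nonempty) (huv : v.card = u.card) (hv : anovaProj v x ≠ 0) (z : Vec n k) :
    anovaProj u z ∈ vectorSpan ℝ (wreathOrbit x) := by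
  have hn : (n : ℝ) ≠ 0 := NeZero.ne _
  have hC (w : Finset (Fin k)) : (∏ c, if c ∈ w then (n : ℝ) else n * n) ≠ 0 :=
    Finset.prod_ne_zero_iff.mpr fun c _ => by split_ifs <;> simp [hn]
  have hvne : v.Nonempty := Finset.card_pos.mp (huv ▸ Finset.card_pos.mpr hu)
  -- If every pairing vanished, summing over `b` would give a nonzero multiple of `anovaProj v x`.
  obtain ⟨a, b, hab⟩ : ∃ a b, ∑ j, diffVec v a b j * x j ≠ 0 := by
    by_contra! h
    refine hv (funext fun i => (mul_eq_zero.mp ?_).resolve_left (hC v))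
    have := Finset.sum_eq_zero fun b (_ : b ∈ univ) => h i b
    rw [Finset.sum_comm] at this
    simp only [← Finset.sum_mul, sum_diffVec] at this
    rw [anovaProj_apply, Finset.mul_sum, ← this]
    refine Finset.sum_congr rfl fun j _ => ?_
    rw [anovaKernel_comm]
    ring
  have hne : ∀ c ∈ v, a c ≠ b c := fun c hc h => hab (by simp [diffVec_eq_zero hc h])
  have hmem (a' b' : Idx n k) : diffVec u a' b' ∈ vectorSpan ℝ (wreathOrbit x) := by
    by_cases h : ∀ c ∈ u, a' c ≠ b' c
    · obtain ⟨g, rfl, ha, hb⟩ := exists_wreath_smul huv hne h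
      convert comp_inv_smul_mem_vectorSpan (diffVec_mem_vectorSpan hvne hab) g using 1
      funext i
      have := diffVec_smul g v a b (g⁻¹ • i)
      rwa [smul_inv_smul, diffVec_congr ha hb] at this
    · push Not at h
      obtain ⟨c, hc, h⟩ := h
      rw [diffVec_eq_zero hc h]
      exact Submodule.zero_mem _
  rw [← Submodule.smul_mem_iff _ (hC u)]
  have heq : (∏ c, if c ∈ u then (n : ℝ) else n * n) • anovaProj u z =
      ∑ a', z a' • ∑ b', diffVec u a' b' := by
    funext i
    simp only [Pi.smul_apply, Finset.sum_apply, smul_eq_mul, sum_diffVec, anovaProj_apply,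
      Finset.mul_sum]
    exact Finset.sum_congr rfl fun j _ => by ring
  rw [heq]
  exact Submodule.sum_mem _ fun a' _ => Submodule.smul_mem _ _
    (Submodule.sum_mem _ fun b' _ => hmem a' b')

/-! ### Level subspaces and their dimension -/

/-- The vectors whose ANOVA components at all levels in `B` vanish. -/
noncomputable def levelSubmodule (n k : ℕ) (B : Finset ℕ) : Submodule ℝ (Vec n k) :=
  ⨅ u : {u : Finset (Fin k) // u.card ∈ B}, LinearMap.ker (anovaProj u.1)

theorem mem_levelSubmodule {B : Finset ℕ} {z : Vec n k} :
    z ∈ levelSubmodule n k B ↔ ∀ u : Finset (Fin k), u.card ∈ B → anovaProj u z = 0 := by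
  simp [levelSubmodule]

theorem anovaProj_comp_inv_smul_eq_zero {x : Vec n k} {m : ℕ}
    (h : ∀ v : Finset (Fin k), v.card = m → anovaProj v x = 0) (g : Wreath n k)
    {u : Finset (Fin k)} (hu : u.card = m) : anovaProj u (fun j => x (g⁻¹ • j)) = 0 := by
  funext i
  have hmap : (u.map (g.right⁻¹).toEmbedding).map g.right.toEmbedding = u := by
    ext c
    rw [Finset.mem_map_equiv, Finset.mem_map_equiv]
    exact iff_of_eq (congrArg (· ∈ u) (g.right.apply_symm_apply c))
  have := anovaProj_comp_inv_smul g (u.map (g.right⁻¹).toEmbedding) x (g⁻¹ • i)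
  rwa [smul_inv_smul, h _ (by simpa using hu), hmap] at this

theorem anovaProj_empty_comp_inv_smul (x : Vec n k) (g : Wreath n k) :
    anovaProj ∅ (fun j => x (g⁻¹ • j)) = anovaProj ∅ x := by
  funext i
  rw [anovaProj_apply, anovaProj_apply, ← Equiv.sum_comp (MulAction.toPerm g)]
  simp [anovaKernel]

theorem vectorSpan_wreathOrbit [NeZero n] {x : Vec n k} {B : Finset ℕ} (h0 : 0 ∈ B)
    (h1 : ∀ u : Finset (Fin k), u.card ∈ B → u.Nonempty → anovaProj u x = 0)
    (h2 : ∀ u : Finset (Fin k), u.card ∉ B → ∃ v : Finset (Fin k), v.card = u.card ∧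
      anovaProj v x ≠ 0) :
    vectorSpan ℝ (wreathOrbit x) = levelSubmodule n k B := by
  apply le_antisymm
  · rw [vectorSpan_def, Submodule.span_le]
    intro y hy
    obtain ⟨_, ⟨g₁, rfl⟩, _, ⟨g₂, rfl⟩, rfl⟩ := Set.mem_vsub.mp hy
    refine mem_levelSubmodule.mpr fun u hu => ?_
    rw [vsub_eq_sub, map_sub]
    rcases u.eq_empty_or_nonempty with rfl | hne
    · rw [anovaProj_empty_comp_inv_smul, anovaProj_empty_comp_inv_smul, sub_self]
    · have h (v : Finset (Fin k)) (hv : v.card = u.card) : anovaProj v x = 0 :=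
        h1 v (hv ▸ hu) (Finset.card_pos.mp (hv ▸ Finset.card_pos.mpr hne))
      rw [anovaProj_comp_inv_smul_eq_zero h g₁ rfl, anovaProj_comp_inv_smul_eq_zero h g₂ rfl,
        sub_zero]
  · intro z hz
    rw [mem_levelSubmodule] at hz
    rw [← sum_anovaProj z]
    refine Submodule.sum_mem _ fun u _ => ?_
    by_cases hu : u.card ∈ B
    · rw [hz u hu]
      exact Submodule.zero_mem _
    · obtain ⟨v, hv, hvx⟩ := h2 u hu
      refine anovaProj_mem_vectorSpan (Finset.nonempty_iff_ne_empty.mpr ?_) hv hvx z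
      rintro rfl
      exact hu h0

theorem isProj_levelSubmodule [NeZero n] (B : Finset ℕ) :
    LinearMap.IsProj (levelSubmodule n k B)
      (∑ u : Finset (Fin k) with u.card ∉ B, anovaProj (n := n) u) where
  map_mem z := by
    refine mem_levelSubmodule.mpr fun v hv => ?_
    rw [LinearMap.sum_apply, map_sum]
    refine Finset.sum_eq_zero fun u hu => ?_
    rw [anovaProj_anovaProj, if_neg]
    rintro rfl
    exact (Finset.mem_filter.mp hu).2 hv
  map_id z hz := by
    rw [mem_levelSubmodule] at hz
    conv_rhs => rw [← sum_anovaProj z]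
    rw [LinearMap.sum_apply, Finset.sum_filter]
    refine Finset.sum_congr rfl fun u _ => ?_
    split_ifs with hu
    · rw [hz u hu]
    · rfl

theorem finrank_levelSubmodule [NeZero n] {B : Finset ℕ} (hB : B ⊆ Finset.range (k + 1)) :
    (Module.finrank ℝ (levelSubmodule n k B) : ℤ) =
      (n : ℤ) ^ k - ∑ j ∈ B, (k.choose j : ℤ) * ((n : ℤ) - 1) ^ j := by
  have h := (isProj_levelSubmodule (n := n) (k := k) B).trace
  rw [map_sum] at h
  simp only [trace_anovaProj] at h
  have hZ : ∑ u : Finset (Fin k) with u.card ∉ B, ((n : ℤ) - 1) ^ u.card =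
      Module.finrank ℝ (levelSubmodule n k B) := by
    exact_mod_cast h
  have hall : ∑ u : Finset (Fin k), ((n : ℤ) - 1) ^ u.card = (n : ℤ) ^ k := by
    have := Finset.sum_pow_mul_eq_add_pow ((n : ℤ) - 1) 1 (univ : Finset (Fin k))
    simpa using this
  have hB' : ∑ u : Finset (Fin k) with u.card ∈ B, ((n : ℤ) - 1) ^ u.card =
      ∑ j ∈ B, (k.choose j : ℤ) * ((n : ℤ) - 1) ^ j := by
    have := Finset.sum_powerset_apply_card (fun j => if j ∈ B then ((n : ℤ) - 1) ^ j else 0)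
      (x := (univ : Finset (Fin k)))
    rw [Finset.powerset_univ, ← Finset.sum_filter] at this
    rw [this]
    simp only [smul_ite, smul_zero, Finset.card_univ, Fintype.card_fin, nsmul_eq_mul]
    rw [Finset.sum_ite_mem, Finset.inter_eq_right.mpr hB]
  rw [← hZ, ← hall, ← hB', ← Finset.sum_filter_add_sum_filter_not univ
    (fun u : Finset (Fin k) => u.card ∈ B) (fun u => ((n : ℤ) - 1) ^ u.card)]
  ring

/-! ### Integrality and the divisibility condition -/

theorem anovaProj_eq_sum_marginal (u : Finset (Fin k)) (x : Vec n k) (i : Idx n k) :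
    anovaProj u x i =
      ∑ t ∈ u.powerset, (-1) ^ (u.card - t.card) * ((n : ℝ)⁻¹ ^ (k - t.card) * marginal x t i) := by
  have hk : u.card ≤ k := by simpa using Finset.card_le_univ u
  simp only [anovaProj_apply, marginal_eq_sum, Finset.mul_sum]
  rw [Finset.sum_comm]
  refine Finset.sum_congr rfl fun a _ => ?_
  have h := Finset.prod_add (fun c => if i c = a c then (1 : ℝ) else 0) (fun _ => -(n : ℝ)⁻¹) u
  simp only [← sub_eq_add_neg] at h
  rw [anovaKernel, prod_ite_mem_const, h, Finset.sum_mul, Finset.sum_mul]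
  refine Finset.sum_congr rfl fun t ht => ?_
  have htu := Finset.mem_powerset.mp ht
  have hc := Finset.card_le_card htu
  rw [Finset.prod_const, Finset.card_sdiff_of_subset htu, neg_pow,
    show k - t.card = (u.card - t.card) + (k - u.card) by omega, pow_add]
  ring

theorem J_eq_zero_iff [NeZero n] (x : Vec n k) (u : Finset (Fin k)) :
    (∀ i, J x u i = 0) ↔ anovaProj u x = 0 := by
  have hn : (n : ℝ) ^ k ≠ 0 := pow_ne_zero _ (NeZero.ne _)
  simp [J, anova_eq_anovaProj, funext_iff, hn]

theorem pow_mul_inv_pow_sub {r : ℝ} (hr : r ≠ 0) {m l : ℕ} (h : l ≤ m) :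
    r ^ m * r⁻¹ ^ (m - l) = r ^ l := by
  rw [inv_pow, ← pow_sub₀ _ hr (Nat.sub_le m l), Nat.sub_sub_self h]

/-- A vector of strength `s` has constant marginals on at most `s` coordinates. -/
theorem pow_mul_marginal_of_eqConstraints [NeZero n] {s lam : ℕ} {x : Vec n k}
    (hx : EqConstraints s lam x) {t : Finset (Fin k)} (ht : t.card ≤ s) (i : Idx n k) :
    (n : ℝ) ^ t.card * marginal x t i = lam * (n : ℝ) ^ s := by
  have hn : (n : ℝ) ≠ 0 := NeZero.ne _
  have hk : t.card ≤ k := by simpa using Finset.card_le_univ t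
  have h := sum_anovaProj_powerset x t i
  rw [Finset.sum_eq_single_of_mem ∅ (Finset.empty_mem_powerset t)] at h
  · have h0 := hx.1 i
    rw [J, anova_eq_anovaProj, h] at h0
    rw [← h0, ← mul_assoc, pow_mul_inv_pow_sub hn hk]
  · intro v hv hne
    have := (J_eq_zero_iff x v).mp (hx.2 v
      (Finset.card_pos.mpr (Finset.nonempty_iff_ne_empty.mpr hne))
      ((Finset.card_le_card (Finset.mem_powerset.mp hv)).trans ht))
    simp [this]

theorem sum_neg_one_pow_card_eq_choose {m s : ℕ} (hm : s < m) {u : Finset (Fin k)}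
    (hu : u.card = m) :
    ∑ t ∈ u.powerset, (-1 : ℤ) ^ t.card * (if t.card ≤ s then 1 else 0) =
      (-1) ^ s * (m - 1).choose s := by
  rw [Finset.sum_powerset_apply_card (fun j => (-1 : ℤ) ^ j * (if j ≤ s then 1 else 0)), hu]
  obtain ⟨m, rfl⟩ : ∃ m', m = m' + 1 := ⟨m - 1, by omega⟩
  rw [Nat.add_sub_cancel, ← Int.alternating_sum_range_choose_eq_choose]
  symm
  apply Finset.sum_subset_zero_on_sdiff
  · intro j
    simp only [Finset.mem_range]
    omega
  · intro j hj
    simp only [Finset.mem_sdiff, Finset.mem_range] at hj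
    rw [if_neg (by omega)]
    simp
  · intro j hj
    rw [if_pos (by simpa [Nat.lt_succ_iff] using hj)]
    simp [mul_comm]

/-- The divisibility condition forced by a vanishing ANOVA component. -/
theorem dvd_mul_choose_of_anovaProj_eq_zero [NeZero n] {s lam : ℕ} {x : Vec n k}
    (hx : EqConstraints s lam x) (hint : ∀ i, ∃ m : ℤ, x i = m) {u : Finset (Fin k)}
    (hu : s < u.card) (h : anovaProj u x = 0) : n ∣ lam * (u.card - 1).choose s := by
  have hn : (n : ℝ) ≠ 0 := NeZero.ne _
  choose y hy using hint
  let i : Idx n k := fun _ => 0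
  let N (t : Finset (Fin k)) : ℤ := ∑ i' : Idx n k with ∀ j ∈ t, i' j = i j, y i'
  have hN (t : Finset (Fin k)) : marginal x t i = N t := by
    simp [marginal, N, hy]
  -- The scaled marginal `n ^ (|t| - s) * marginal`, which is an integer even for `|t| < s` because
  -- there it equals `lam`.
  let q (t : Finset (Fin k)) : ℤ := if t.card ≤ s then lam else n ^ (t.card - s) * N t
  have hq (t : Finset (Fin k)) : (n : ℝ) ^ t.card * marginal x t i = (n : ℝ) ^ s * q t := by
    by_cases ht : t.card ≤ s
    · rw [pow_mul_marginal_of_eqConstraints hx ht]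
      simp [q, ht, mul_comm]
    · simp only [q, ht, if_false, hN]
      push_cast
      rw [← mul_assoc, ← pow_add]
      congr 2
      omega
  have hsumR : ∑ t ∈ u.powerset, (-1 : ℝ) ^ t.card * q t = 0 := by
    have h' := congrFun h i
    rw [anovaProj_eq_sum_marginal] at h'
    have : ∑ t ∈ u.powerset, (-1 : ℝ) ^ t.card * q t = (-1) ^ u.card * (n : ℝ) ^ k *
        ((n : ℝ) ^ s)⁻¹ * ∑ t ∈ u.powerset,
          (-1) ^ (u.card - t.card) * ((n : ℝ)⁻¹ ^ (k - t.card) * marginal x t i) := by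
      rw [Finset.mul_sum]
      refine Finset.sum_congr rfl fun t ht => ?_
      have htu := Finset.card_le_card (Finset.mem_powerset.mp ht)
      have htk : t.card ≤ k := by simpa using Finset.card_le_univ t
      have hq' : (q t : ℝ) = ((n : ℝ) ^ s)⁻¹ * ((n : ℝ) ^ t.card * marginal x t i) := by
        rw [hq]
        field_simp
      have hsgn : (-1 : ℝ) ^ u.card * (-1) ^ (u.card - t.card) = (-1) ^ t.card := by
        rw [← pow_add, show u.card + (u.card - t.card) = t.card + 2 * (u.card - t.card) by omega,
          pow_add, pow_mul]
        simp
      rw [hq', ← hsgn, ← pow_mul_inv_pow_sub hn htk]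
      ring
    rw [this, h']
    simp
  have hsum : ∑ t ∈ u.powerset, (-1 : ℤ) ^ t.card * q t = 0 := by exact_mod_cast hsumR
  -- Modulo `n` only the terms with `|t| ≤ s` survive.
  have hmod : (n : ℤ) ∣ ∑ t ∈ u.powerset, (-1 : ℤ) ^ t.card * q t -
      lam * ∑ t ∈ u.powerset, (-1 : ℤ) ^ t.card * (if t.card ≤ s then 1 else 0) := by
    rw [Finset.mul_sum, ← Finset.sum_sub_distrib]
    refine Finset.dvd_sum fun t _ => ?_
    by_cases ht : t.card ≤ s
    · simp [q, ht, mul_comm]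
    · simp only [q, ht, if_false, mul_zero, sub_zero]
      exact Dvd.dvd.mul_left (Dvd.dvd.mul_right (dvd_pow_self _ (by omega)) _) _
  rw [hsum, zero_sub, dvd_neg, sum_neg_one_pow_card_eq_choose hu rfl, mul_left_comm,
    (isUnit_one.neg.pow s).dvd_mul_left] at hmod
  exact_mod_cast hmod

end OAPolytope

/-! ### Assembly of the main theorem -/

open OAPolytope Finset in
theorem mainTheorem3 (n k s lam pmax : ℕ) (hn : 2 ≤ n) (hs : 1 ≤ s) (hsk : s ≤ k)
    (hlam : 1 ≤ lam) (hp : 1 ≤ pmax) (hpl : pmax ≤ lam)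
    (x : OAPolytope.Vec n k) (hx : OAPolytope.IsFeasible s lam pmax x) :
    ∃ T : Finset ℕ, T ⊆ OAPolytope.Omega n k s lam ∧
      ((OAPolytope.dim (convexHull ℝ (OAPolytope.wreathOrbit x)) : ℤ) =
        (n : ℤ) ^ k - ∑ j ∈ Finset.range (s + 1), (k.choose j : ℤ) * ((n : ℤ) - 1) ^ j
          - ∑ l ∈ T, (k.choose (s + l) : ℤ) * ((n : ℤ) - 1) ^ (s + l)) ∧
      ∃ (r : ℕ) (u : Fin r → Finset (Fin k)) (l : Fin r → ℕ),
        (∀ j, l j ∈ T ∧ (u j).card = s + l j ∧ s + l j ≤ k) ∧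
        (affineSpan ℝ (convexHull ℝ (OAPolytope.wreathOrbit x)) : Set (OAPolytope.Vec n k)) =
          {z | OAPolytope.EqConstraints s lam z ∧
            ∀ j, ∀ u'' : Finset (Fin k), u''.card = (u j).card →
              ∀ i, OAPolytope.J z u'' i = 0} ∧
        affineSpan ℝ (convexHull ℝ (OAPolytope.wreathOrbit x)) =
          affineSpan ℝ (OAPolytope.wreathOrbit x) := by
  classical
  have : NeZero n := ⟨by omega⟩
  obtain ⟨hxE, hxI⟩ := hx
  have hcard (u : Finset (Fin k)) : u.card ≤ k := by simpa using Finset.card_le_univ u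
  have hlow (z : Vec n k) (hz : EqConstraints s lam z) (u : Finset (Fin k)) (hu : u.Nonempty)
      (hus : u.card ≤ s) : anovaProj u z = 0 :=
    (J_eq_zero_iff z u).mp (hz.2 u (Finset.card_pos.mpr hu) hus)
  let T : Finset ℕ := {l ∈ Finset.Icc 1 (k - s) |
    ∀ u : Finset (Fin k), u.card = s + l → anovaProj u x = 0}
  have hT (l : ℕ) : l ∈ T ↔ (1 ≤ l ∧ l ≤ k - s) ∧
      ∀ u : Finset (Fin k), u.card = s + l → anovaProj u x = 0 := by
    simp [T]
  have hex (l : ℕ) (hl : l ∈ T) : ∃ u : Finset (Fin k), u.card = s + l := by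
    obtain ⟨u, -, hu⟩ := Finset.exists_subset_card_eq (s := (univ : Finset (Fin k))) (n := s + l)
      (by rw [Finset.card_univ, Fintype.card_fin]; have := ((hT l).mp hl).1; omega)
    exact ⟨u, hu⟩
  let B : Finset ℕ := Finset.range (s + 1) ∪ T.map (addLeftEmbedding s)
  have hB (j : ℕ) : j ∈ B ↔ j ≤ s ∨ ∃ l ∈ T, s + l = j := by
    simp [B]
  have hBk : B ⊆ Finset.range (k + 1) := by
    intro j hj
    rw [Finset.mem_range]
    rcases (hB j).mp hj with h | ⟨l, hl, rfl⟩
    · omega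
    · have := ((hT l).mp hl).1
      omega
  have hspan : vectorSpan ℝ (wreathOrbit x) = levelSubmodule n k B := by
    refine vectorSpan_wreathOrbit ((hB 0).mpr (Or.inl (Nat.zero_le s))) (fun u hu hne => ?_)
      fun u hu => ?_
    · rcases (hB _).mp hu with h | ⟨l, hl, h⟩
      · exact hlow x hxE u hne h
      · exact ((hT l).mp hl).2 u h.symm
    · rw [hB] at hu
      push Not at hu
      have h : u.card - s ∉ T := fun h => hu.2 _ h (by omega)
      rw [hT] at h
      push Not at h
      obtain ⟨v, hv, hvx⟩ := h ⟨by omega, Nat.sub_le_sub_right (hcard u) s⟩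
      exact ⟨v, by omega, hvx⟩
  -- One subset of size `s + l` is chosen for each `l ∈ T`.
  refine ⟨T, fun l hl => ?_, ?_, T.card, fun j => (hex _ (T.equivFin.symm j).2).choose,
    fun j => T.equivFin.symm j, fun j => ⟨(T.equivFin.symm j).2,
      (hex _ (T.equivFin.symm j).2).choose_spec, ?_⟩, ?_, affineSpan_convexHull _⟩
  · obtain ⟨u, hu⟩ := hex l hl
    have hl' := (hT l).mp hl
    refine Finset.mem_filter.mpr ⟨Finset.mem_Icc.mpr hl'.1, ?_⟩
    have := dvd_mul_choose_of_anovaProj_eq_zero hxE (fun i => (hxI i).2.2) (by omega) (hl'.2 u hu)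
    rw [hu] at this
    rw [Nat.modEq_zero_iff_dvd, Nat.choose_symm_of_eq_add (b := s) (by omega)]
    exact this
  · rw [dim, affineSpan_convexHull, direction_affineSpan, hspan, finrank_levelSubmodule hBk,
      Finset.sum_union, Finset.sum_map, sub_sub]
    · simp
    · rw [Finset.disjoint_left]
      intro j hj hj'
      obtain ⟨l, hl, rfl⟩ := Finset.mem_map.mp hj'
      have := ((hT l).mp hl).1
      simp at hj
      omega
  · rw [← (hex _ (T.equivFin.symm j).2).choose_spec]
    exact hcard _
  · ext z
    have hmem : z ∈ affineSpan ℝ (wreathOrbit x) ↔ z - x ∈ levelSubmodule n k B := by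
      rw [← hspan, ← direction_affineSpan, ← vsub_eq_sub,
        AffineSubspace.vsub_right_mem_direction_iff_mem
          (mem_affineSpan ℝ (self_mem_wreathOrbit x))]
    rw [affineSpan_convexHull, SetLike.mem_coe, hmem, mem_levelSubmodule, Set.mem_ofPred_eq]
    simp only [map_sub, sub_eq_zero, J_eq_zero_iff]
    have hJ : (∀ i, J z ∅ i = lam * (n : ℝ) ^ s) ↔ anovaProj ∅ z = anovaProj ∅ x := by
      have hnk : (n : ℝ) ^ k ≠ 0 := pow_ne_zero _ (NeZero.ne _)
      rw [funext_iff]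
      refine forall_congr' fun i => ?_
      rw [← hxE.1 i, J, J, anova_eq_anovaProj, anova_eq_anovaProj, mul_right_inj' hnk]
    constructor
    · intro h
      refine ⟨⟨hJ.mpr (h ∅ ((hB _).mpr (Or.inl (by simp)))), fun u hu hus => ?_⟩,
        fun j u hu => ?_⟩
      · rw [J_eq_zero_iff, h u ((hB _).mpr (Or.inl hus)), hlow x hxE u (Finset.card_pos.mp hu) hus]
      · rw [(hex _ (T.equivFin.symm j).2).choose_spec] at hu
        rw [h u ((hB _).mpr (Or.inr ⟨_, (T.equivFin.symm j).2, hu.symm⟩))]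
        exact ((hT _).mp (T.equivFin.symm j).2).2 u hu
    · rintro ⟨hz, hzT⟩ u hu
      rcases u.eq_empty_or_nonempty with rfl | hne
      · exact hJ.mp hz.1
      rcases (hB _).mp hu with h | ⟨l, hl, h⟩
      · rw [hlow z hz u hne h, hlow x hxE u hne h]
      · rw [((hT l).mp hl).2 u h.symm]
        refine hzT (T.equivFin ⟨l, hl⟩) u ?_
        rw [(hex _ (T.equivFin.symm (T.equivFin ⟨l, hl⟩)).2).choose_spec]
        simp [← h]
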